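/- Let $k\ge 1$ be an integer and $\ell=\lceil k/2\rceil$. A (non-crossing) matching of size $k$ is a partition of $2k$ points $P_1,\dots,P_{2k}$, labeled in cyclic order, into $k$ pairs (edges) no two of which cross, where two disjoint pairs cross if they alternate in the cyclic order (equivalently, it is a non-crossing straight-line perfect matching of $2k$ labeled points in convex position). A ring is a matching all of whose edges connect cyclically consecutive points. A matching $N$ of size $k$ is obtained from a matching $M$ of size $k-2$ by inserting a block if for some $i$ (indices modulo $2k$) the pairs $P_iP_{i+3}$ and $P_{i+1}P_{i+2}$ are edges of $N$, and the remaining points of $N$, relabeled $1,\dots,2k-4$ in increasing order of their labels, are matched as in $M$. L-matchings are defined recursively: an L-matching is a ring of size $2$, a ring of size $3$, or a matching of size $k\ge 4$ that can be obtained from an L-matching of size $k-2$ by inserting a block in any place. Theorem. (1) If $k$ is odd, the number of L-matchings of size $k$ is $$\frac{2}{3}\,\frac{\ell-1}{\ell}\binom{4\ell-2}{\ell-1}.$$ (2) If $k$ is even, the number of L-matchings of size $k$ is $$\frac{\ell+1}{3\ell+1}\binom{4\ell}{\ell}.$$ -/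

import Mathlib

/-- A (combinatorial) non-crossing perfect matching of size `k`: a partition of the `2 * k` points
`0, 1, …, 2 * k - 1`, labelled in cyclic order, into `k` pairs no two of which cross.
It is recorded by the function sending each point to the point it is matched with; the edges are
the pairs `{a, partner a}`. Two pairs cross if they alternate (`abab`) in the cyclic order,
that is, if for suitable names `a < b < a' < b'` the pairs are `{a, a'}` and `{b, b'}`. -/
@[ext]
structure NCMatching (k : ℕ) where
  /-- the point matched with a given point -/
  partner : Fin (2 * k) → Fin (2 * k)
  partner_partner : ∀ a, partner (partner a) = a
  partner_ne : ∀ a, partner a ≠ a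
  noncrossing : ∀ a b, ¬ (a < b ∧ b < partner a ∧ partner a < partner b)

namespace NCMatching

instance finite (k : ℕ) : Finite (NCMatching k) :=
  Finite.of_injective (fun M : NCMatching k => M.partner) fun _ _ h => NCMatching.ext h

/-- The point `b` comes right after the point `a` in the cyclic order of the `n` points. -/
def Next {n : ℕ} (a b : Fin n) : Prop :=
  (b : ℕ) = ((a : ℕ) + 1) % n

/-- A ring: all edges are boundary edges, that is, they connect cyclically consecutive points. -/
def IsRing {k : ℕ} (M : NCMatching k) : Prop :=
  ∀ a, Next a (M.partner a) ∨ Next (M.partner a) a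

/-- `N` is obtained from `M` by inserting a block: there are four cyclically consecutive points
`p, q, r, s` such that `{p, s}` and `{q, r}` are edges of `N`, and the other points of `N`,
relabelled in increasing order, are matched exactly as in `M`.
The case where `p, q, r, s` run through the last and the first label together corresponds to
insertions between the last and the first point of `M`, where each of the inserted points
may receive the first label. -/
def IsBlockInsertion {k : ℕ} (M : NCMatching k) (N : NCMatching (k + 2)) : Prop :=
  ∃ p q r s : Fin (2 * (k + 2)),
    Next p q ∧ Next q r ∧ Next r s ∧ N.partner p = s ∧ N.partner q = r ∧
    ∃ f : Fin (2 * k) ↪o Fin (2 * (k + 2)),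
      Set.range f = ({p, q, r, s} : Set (Fin (2 * (k + 2))))ᶜ ∧
      ∀ a, N.partner (f a) = f (M.partner a)

/-- L-matchings: the rings of size `2`, the rings of size `3`, and every matching of size at
least `4` obtained from an L-matching whose size is smaller by `2` by inserting a block in
any place. -/
inductive IsLMatching : {k : ℕ} → NCMatching k → Prop
  | ring_two (M : NCMatching 2) : M.IsRing → IsLMatching M
  | ring_three (M : NCMatching 3) : M.IsRing → IsLMatching M
  | insert_block {k : ℕ} (M : NCMatching k) (N : NCMatching (k + 2)) :
      IsLMatching M → IsBlockInsertion M N → IsLMatching N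

end NCMatching

/-! A non-crossing matching is a binary tree: the edge at the first point is the root, the left
subtree is what it encloses, the right subtree what follows. A block that does not straddle the cut
between the last and the first label is planted in one gap of the tree (`Insertion`). One that does
straddle it changes the whole tree in one of three ways (`isBlockInsertion_iff`).

L-matchings are therefore the trees reachable from the two rings of size 2 and the two of size 3,
and they are described by a finite grammar (`TreeClass.Mem`). Linear insertions generate T from
nothing and O from a single edge. In F and G, once the edges peeled off by `cons` are gone, the
first edge is a base edge or belongs to a straddling block. Nonempty T-trees and F-trees come from
the rings of size 2, G-trees from those of size 3. The union is stable under insertions, and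
conversely each derivation can be replayed by insertions (`isLMatching_iff`).

Parity and `disjoint_classes` make derivations unique, so the grammar becomes a system of equations
for generating functions, with X marking edges: T = 1 + X²T⁴, (4 - 3T)F = X²T⁵ and (4 - 3T)G =
2X³T⁷. The series B_r of the numbers C(4n + r, n) in X² equals T^(r+1)/(4 - 3T). Hence T + F = 3B_0
- 2B_1 counts the even sizes and G = 2X³B_6 the odd ones. -/

open BinaryTree

/-! ### Binary trees as non-crossing matchings -/

/-- The non-crossing matching of `0, …, 2 * t.numNodes - 1` encoded by a binary tree, as a function
on `ℕ`: the root is the edge from `0`, the left subtree encodes what lies under it, and the right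
subtree what comes after it. -/
def BinaryTree.mate : BinaryTree Unit → ℕ → ℕ
  | nil, x => x
  | node _ a b, x =>
    if x = 0 then 2 * a.numNodes + 1
    else if x ≤ 2 * a.numNodes then a.mate (x - 1) + 1
    else if x = 2 * a.numNodes + 1 then 0
    else b.mate (x - (2 * a.numNodes + 2)) + (2 * a.numNodes + 2)

namespace BinaryTree

lemma mate_node_zero (a b : BinaryTree Unit) : (node () a b).mate 0 = 2 * a.numNodes + 1 := by
  simp [mate]

lemma mate_node_left (a b : BinaryTree Unit) {x : ℕ} (hx : x < 2 * a.numNodes) :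
    (node () a b).mate (x + 1) = a.mate x + 1 := by
  simp [mate, show x + 1 ≤ 2 * a.numNodes from hx]

lemma mate_node_close (a b : BinaryTree Unit) :
    (node () a b).mate (2 * a.numNodes + 1) = 0 := by
  simp [mate]

lemma mate_node_right (a b : BinaryTree Unit) (x : ℕ) :
    (node () a b).mate (x + (2 * a.numNodes + 2)) = b.mate x + (2 * a.numNodes + 2) := by
  simp only [mate]
  rw [if_neg (by omega), if_neg (by omega), if_neg (by omega)]
  simp

/-- The four kinds of points of the matching encoded by a tree with a root. -/
lemma point_cases (a b : BinaryTree Unit) {x : ℕ} (hx : x < 2 * (node () a b).numNodes) :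
    x = 0 ∨ (∃ y < 2 * a.numNodes, x = y + 1) ∨ x = 2 * a.numNodes + 1 ∨
      ∃ y < 2 * b.numNodes, x = y + (2 * a.numNodes + 2) := by
  simp only [numNodes] at hx
  rcases Nat.eq_zero_or_pos x with h | h
  · exact Or.inl h
  rcases Nat.lt_trichotomy x (2 * a.numNodes + 1) with h1 | h1 | h1
  · exact Or.inr (Or.inl ⟨x - 1, by omega, by omega⟩)
  · exact Or.inr (Or.inr (Or.inl h1))
  · exact Or.inr (Or.inr (Or.inr ⟨x - (2 * a.numNodes + 2), by omega, by omega⟩))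

lemma mate_lt (t : BinaryTree Unit) : ∀ x < 2 * t.numNodes, t.mate x < 2 * t.numNodes := by
  induction t with
  | nil => simp
  | node _ a b iha ihb =>
    intro x hx
    rcases point_cases a b hx with rfl | ⟨y, hy, rfl⟩ | rfl | ⟨y, hy, rfl⟩
    · rw [mate_node_zero]; simp only [numNodes]; omega
    · rw [mate_node_left a b hy]; have := iha y hy; simp only [numNodes]; omega
    · rw [mate_node_close]; simp only [numNodes]; omega
    · rw [mate_node_right]; have := ihb y hy; simp only [numNodes]; omega

lemma mate_mate (t : BinaryTree Unit) : ∀ x < 2 * t.numNodes, t.mate (t.mate x) = x := by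
  induction t with
  | nil => simp
  | node _ a b iha ihb =>
    intro x hx
    rcases point_cases a b hx with rfl | ⟨y, hy, rfl⟩ | rfl | ⟨y, hy, rfl⟩
    · rw [mate_node_zero, mate_node_close]
    · rw [mate_node_left a b hy, mate_node_left a b (mate_lt a y hy), iha y hy]
    · rw [mate_node_close, mate_node_zero]
    · rw [mate_node_right, mate_node_right, ihb y hy]

lemma mate_ne (t : BinaryTree Unit) : ∀ x < 2 * t.numNodes, t.mate x ≠ x := by
  induction t with
  | nil => simp
  | node _ a b iha ihb =>
    intro x hx
    rcases point_cases a b hx with rfl | ⟨y, hy, rfl⟩ | rfl | ⟨y, hy, rfl⟩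
    · rw [mate_node_zero]; omega
    · rw [mate_node_left a b hy]; have := iha y hy; omega
    · rw [mate_node_close]; omega
    · rw [mate_node_right]; have := ihb y hy; omega

lemma mate_noncrossing (t : BinaryTree Unit) : ∀ x < 2 * t.numNodes, ∀ y < 2 * t.numNodes,
    ¬ (x < y ∧ y < t.mate x ∧ t.mate x < t.mate y) := by
  induction t using unitRecOn with
  | base => simp
  | ind a b iha ihb =>
    intro x hx x' hx'
    rcases point_cases a b hx with rfl | ⟨y, hy, rfl⟩ | rfl | ⟨y, hy, rfl⟩ <;>
    rcases point_cases a b hx' with rfl | ⟨y', hy', rfl⟩ | rfl | ⟨y', hy', rfl⟩ <;>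
    simp only [mate_node_zero, mate_node_close, mate_node_right, mate_node_left a b, *] <;>
    first
      | omega
      | (have := mate_lt a y hy; omega)
      | (have := mate_lt a y' hy'; omega)
      | (have := iha y hy y' hy'; omega)
      | (have := ihb y hy y' hy'; omega)

/-- The mate of 0 gives the size of the left subtree, hence where each subtree is read off. -/
lemma eq_of_mate_eq {s t : BinaryTree Unit} (hn : s.numNodes = t.numNodes)
    (h : ∀ x < 2 * s.numNodes, s.mate x = t.mate x) : s = t := by
  induction s generalizing t with
  | nil =>
    cases t with
    | nil => rfl
    | node => simp at hn
  | node _ a b iha ihb =>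
    cases t with
    | nil => simp at hn
    | node _ a' b' =>
      simp only [numNodes] at hn h
      have h0 := h 0 (by omega)
      rw [mate_node_zero, mate_node_zero] at h0
      have ha : a.numNodes = a'.numNodes := by omega
      have e1 : a = a' := by
        refine iha ha fun x hx => ?_
        have := h (x + 1) (by omega)
        rw [mate_node_left a b hx, mate_node_left a' b' (by omega)] at this
        omega
      subst e1
      have e2 : b = b' := by
        refine ihb (by omega) fun x hx => ?_
        have := h (x + (2 * a.numNodes + 2)) (by omega)
        rw [mate_node_right, mate_node_right] at this
        omega
      rw [e2]

/-- Every non-crossing fixed-point free involution of an interval is encoded by a tree. -/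
lemma exists_mate_eq (g : ℕ → ℕ) (hgg : ∀ x, g (g x) = x)
    (hnc : ∀ x y, ¬ (x < y ∧ y < g x ∧ g x < g y)) :
    ∀ n i j : ℕ, j = i + n → (∀ x, i ≤ x → x < j → i ≤ g x ∧ g x < j ∧ g x ≠ x) →
      ∃ t : BinaryTree Unit, 2 * t.numNodes = n ∧ ∀ x < n, g (i + x) = i + t.mate x := by
  intro n
  induction n using Nat.strong_induction_on with
  | _ n ih =>
  intro i j hj hg
  rcases Nat.eq_zero_or_pos n with rfl | hn
  · exact ⟨nil, by simp, by simp⟩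
  obtain ⟨hi1, hi2, hi3⟩ := hg i le_rfl (by omega)
  set c := g i with hc
  have hgc : g c = i := by rw [hc, hgg]
  -- The edge from `i` to `c` cannot be crossed, so `g` preserves both the points under it and those
  -- after it.
  obtain ⟨a, ha, ha'⟩ := ih (c - (i + 1)) (by omega) (i + 1) c (by omega) (by
    intro x hx hxc
    obtain ⟨h1, h2, h3⟩ := hg x (by omega) (by omega)
    have := hnc i x
    have e1 : g x ≠ i := by
      intro h; have := hgg x; rw [h] at this; omega
    have e2 : g x ≠ c := by
      intro h; have := hgg x; rw [h] at this; omega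
    omega)
  obtain ⟨b, hb, hb'⟩ := ih (j - (c + 1)) (by omega) (c + 1) j (by omega) (by
    intro x hx hxc
    obtain ⟨h1, h2, h3⟩ := hg x (by omega) (by omega)
    have := hnc i (g x)
    rw [hgg] at this
    have e1 : g x ≠ i := by
      intro h; have := hgg x; rw [h] at this; omega
    have e2 : g x ≠ c := by
      intro h; have := hgg x; rw [h] at this; omega
    omega)
  refine ⟨node () a b, by simp only [numNodes]; omega, fun x hx => ?_⟩
  have hx' : x < 2 * (node () a b).numNodes := by simp only [numNodes]; omega
  rcases point_cases a b hx' with rfl | ⟨y, hy, rfl⟩ | rfl | ⟨y, hy, rfl⟩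
  · rw [mate_node_zero, add_zero, ← hc]; omega
  · rw [mate_node_left a b hy]
    have := ha' y (by omega)
    rw [show i + (y + 1) = i + 1 + y by omega, this]; omega
  · rw [mate_node_close, show i + (2 * a.numNodes + 1) = c by omega, hgc]; rfl
  · rw [mate_node_right]
    have := hb' y (by omega)
    rw [show i + (y + (2 * a.numNodes + 2)) = c + 1 + y by omega, this]; omega

/-! ### Block insertion on trees -/

/-- `t` is obtained from `s` by inserting a block at consecutive points whose first one is not
preceded by the others in the linear order. -/
inductive Insertion : BinaryTree Unit → BinaryTree Unit → Prop
  | here (t) : Insertion t (node () (node () nil nil) t)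
  | left {a a'} (b) : Insertion a a' → Insertion (node () a b) (node () a' b)
  | right (a) {b b'} : Insertion b b' → Insertion (node () a b) (node () a b')

/-- `g` restricted to the complement of `{p, q, r, s}` is `f` transported along `σ`, and `g`
matches `p` with `s` and `q` with `r`. -/
structure IsBlockExtension (n : ℕ) (f g σ : ℕ → ℕ) (p q r s : ℕ) : Prop where
  outer : g p = s
  inner : g q = r
  outer' : g s = p
  inner' : g r = q
  rest : ∀ x < n, g (σ x) = σ (f x)

/-- The increasing enumeration of the complement of `{p, p + 1, p + 2, p + 3}`. -/
def skipFour (p x : ℕ) : ℕ := if x < p then x else x + 4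

lemma isBlockExtension_here (t : BinaryTree Unit) :
    IsBlockExtension (2 * t.numNodes) t.mate (node () (node () nil nil) t).mate (skipFour 0)
      0 1 2 3 := by
  refine ⟨by simp [mate], by simp [mate], by simp [mate], by simp [mate], fun x _ => ?_⟩
  simpa [skipFour] using mate_node_right (node () nil nil) t x

/-- The bound on `p` keeps the block under the root edge: `skipFour (p + 1)` fixes 0 and moves the
closing point and all later ones by four. -/
lemma IsBlockExtension.left {a a' : BinaryTree Unit} (b : BinaryTree Unit) {p : ℕ}
    (hp : p ≤ 2 * a.numNodes) (hn : a'.numNodes = a.numNodes + 2)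
    (h : IsBlockExtension (2 * a.numNodes) a.mate a'.mate (skipFour p)
      p (p + 1) (p + 2) (p + 3)) :
    IsBlockExtension (2 * (node () a b).numNodes) (node () a b).mate (node () a' b).mate
      (skipFour (p + 1)) (p + 1) (p + 1 + 1) (p + 1 + 2) (p + 1 + 3) := by
  refine ⟨?_, ?_, ?_, ?_, fun x hx => ?_⟩
  · rw [mate_node_left _ _ (by omega), h.outer]
  · rw [mate_node_left _ _ (by omega), h.inner]
  · rw [show p + 1 + 3 = p + 3 + 1 by omega, mate_node_left _ _ (by omega), h.outer']
  · rw [show p + 1 + 2 = p + 2 + 1 by omega, mate_node_left _ _ (by omega), h.inner']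
  · have e1 : ∀ y, skipFour (p + 1) (y + 1) = skipFour p y + 1 := by
      intro y; simp only [skipFour]; split_ifs <;> omega
    rcases point_cases a b hx with rfl | ⟨y, hy, rfl⟩ | rfl | ⟨y, hy, rfl⟩
    · rw [mate_node_zero, show skipFour (p + 1) 0 = 0 by simp [skipFour], mate_node_zero]
      simp only [skipFour]; split_ifs <;> omega
    · rw [mate_node_left a b hy, e1, e1, mate_node_left, h.rest y hy]
      simp only [skipFour]; split_ifs <;> omega
    · rw [mate_node_close, show skipFour (p + 1) (2 * a.numNodes + 1) = 2 * a'.numNodes + 1 by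
        simp only [skipFour]; split_ifs <;> omega, mate_node_close]
      simp [skipFour]
    · have e2 : ∀ y, skipFour (p + 1) (y + (2 * a.numNodes + 2)) =
          y + (2 * a'.numNodes + 2) := by
        intro y; simp only [skipFour]; split_ifs <;> omega
      rw [mate_node_right, e2, e2, mate_node_right]

lemma IsBlockExtension.right (a : BinaryTree Unit) {b b' : BinaryTree Unit} {p : ℕ}
    (h : IsBlockExtension (2 * b.numNodes) b.mate b'.mate (skipFour p)
      p (p + 1) (p + 2) (p + 3)) :
    IsBlockExtension (2 * (node () a b).numNodes) (node () a b).mate (node () a b').mate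
      (skipFour (p + (2 * a.numNodes + 2))) (p + (2 * a.numNodes + 2))
      (p + (2 * a.numNodes + 2) + 1) (p + (2 * a.numNodes + 2) + 2)
      (p + (2 * a.numNodes + 2) + 3) := by
  refine ⟨?_, ?_, ?_, ?_, fun x hx => ?_⟩
  · rw [mate_node_right, h.outer]; omega
  · rw [show p + (2 * a.numNodes + 2) + 1 = p + 1 + (2 * a.numNodes + 2) by omega,
      mate_node_right, h.inner]; omega
  · rw [show p + (2 * a.numNodes + 2) + 3 = p + 3 + (2 * a.numNodes + 2) by omega,
      mate_node_right, h.outer']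
  · rw [show p + (2 * a.numNodes + 2) + 2 = p + 2 + (2 * a.numNodes + 2) by omega,
      mate_node_right, h.inner']; omega
  · have e0 : ∀ y ≤ 2 * a.numNodes + 1, skipFour (p + (2 * a.numNodes + 2)) y = y := by
      intro y hy; simp only [skipFour]; split_ifs <;> omega
    rcases point_cases a b hx with rfl | ⟨y, hy, rfl⟩ | rfl | ⟨y, hy, rfl⟩
    · rw [e0 _ (by omega), mate_node_zero, mate_node_zero, e0 _ (by omega)]
    · have := mate_lt a y hy
      rw [e0 _ (by omega), mate_node_left _ _ hy, mate_node_left _ _ hy, e0 _ (by omega)]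
    · rw [e0 _ (by omega), mate_node_close, mate_node_close, e0 _ (by omega)]
    · have e2 : ∀ y, skipFour (p + (2 * a.numNodes + 2)) (y + (2 * a.numNodes + 2)) =
          skipFour p y + (2 * a.numNodes + 2) := by
        intro y; simp only [skipFour]; split_ifs <;> omega
      rw [mate_node_right, e2, e2, mate_node_right, h.rest y hy]

lemma Insertion.numNodes {t t' : BinaryTree Unit} (h : Insertion t t') :
    t'.numNodes = t.numNodes + 2 := by
  induction h with
  | here t => simp only [BinaryTree.numNodes]; omega
  | left b _ ih => simp only [BinaryTree.numNodes]; omega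
  | right a _ ih => simp only [BinaryTree.numNodes]; omega

lemma Insertion.exists_isBlockExtension {t t' : BinaryTree Unit} (h : Insertion t t') :
    ∃ p ≤ 2 * t.numNodes, IsBlockExtension (2 * t.numNodes) t.mate t'.mate (skipFour p)
      p (p + 1) (p + 2) (p + 3) := by
  induction h with
  | here t => exact ⟨0, by omega, isBlockExtension_here t⟩
  | left b h ih =>
    obtain ⟨p, hp, h'⟩ := ih
    exact ⟨p + 1, by simp only [BinaryTree.numNodes]; omega, h'.left b hp h.numNodes⟩
  | right a h ih =>
    obtain ⟨p, hp, h'⟩ := ih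
    exact ⟨_, by simp only [BinaryTree.numNodes]; omega, h'.right a⟩

/-- The gaps of a node are the one before the root edge, those under it, and those after its closing
point; these are the three constructors of `Insertion`. -/
lemma exists_insertion (t : BinaryTree Unit) : ∀ p ≤ 2 * t.numNodes, ∃ t', Insertion t t' ∧
    IsBlockExtension (2 * t.numNodes) t.mate t'.mate (skipFour p) p (p + 1) (p + 2) (p + 3) := by
  induction t with
  | nil =>
    intro p hp
    obtain rfl : p = 0 := by simpa using hp
    exact ⟨_, .here _, isBlockExtension_here _⟩
  | node _ a b iha ihb =>
    intro p hp
    simp only [BinaryTree.numNodes] at hp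
    rcases Nat.eq_zero_or_pos p with rfl | h
    · exact ⟨_, .here _, isBlockExtension_here _⟩
    rcases Nat.lt_or_ge p (2 * a.numNodes + 2) with h1 | h1
    · obtain ⟨p, rfl⟩ : ∃ p', p = p' + 1 := ⟨p - 1, by omega⟩
      obtain ⟨a', h2, h3⟩ := iha p (by omega)
      exact ⟨_, h2.left b, h3.left b (by omega) h2.numNodes⟩
    · obtain ⟨p, rfl⟩ : ∃ p', p = p' + (2 * a.numNodes + 2) :=
        ⟨p - (2 * a.numNodes + 2), by omega⟩
      obtain ⟨b', h2, h3⟩ := ihb p (by omega)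
      exact ⟨_, h2.right a, h3.right a⟩

/-- In the three wrapping cases the suffix counts the block points before the cut. The others take
the first labels, which shifts the old labels by 3, 2 and 1 respectively. -/
lemma isBlockExtension_wrap_one (t : BinaryTree Unit) :
    IsBlockExtension (2 * t.numNodes) t.mate (node () nil (node () t nil)).mate (· + 3)
      (2 * t.numNodes + 3) 0 1 2 := by
  have e : ∀ x, (node () nil (node () t nil)).mate (x + 2) = (node () t nil).mate x + 2 := by
    simpa using mate_node_right nil (node () t nil)
  refine ⟨?_, by simp [mate], ?_, by simp [mate], fun x hx => ?_⟩
  · rw [show 2 * t.numNodes + 3 = 2 * t.numNodes + 1 + 2 by omega, e, mate_node_close]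
  · rw [show (2 : ℕ) = 0 + 2 by omega, e, mate_node_zero]
  · rw [show x + 3 = x + 1 + 2 by omega, e, mate_node_left _ _ hx]

lemma isBlockExtension_wrap_two (t : BinaryTree Unit) :
    IsBlockExtension (2 * t.numNodes) t.mate (node () (node () t nil) nil).mate (· + 2)
      (2 * t.numNodes + 2) (2 * t.numNodes + 3) 0 1 := by
  have e : ∀ x < 2 * t.numNodes + 2,
      (node () (node () t nil) nil).mate (x + 1) = (node () t nil).mate x + 1 := by
    intro x hx
    exact mate_node_left _ _ (by simp only [numNodes]; omega)
  have hn : 2 * (node () t nil).numNodes + 1 = 2 * t.numNodes + 3 := by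
    simp only [numNodes]; omega
  refine ⟨?_, ?_, ?_, ?_, fun x hx => ?_⟩
  · rw [show 2 * t.numNodes + 2 = 2 * t.numNodes + 1 + 1 by omega, e _ (by omega),
      mate_node_close]
  · rw [← hn, mate_node_close]
  · rw [show (1 : ℕ) = 0 + 1 by omega, e _ (by omega), mate_node_zero]
  · rw [mate_node_zero, hn]
  · rw [show x + 2 = x + 1 + 1 by omega, e _ (by omega), mate_node_left _ _ hx]

lemma isBlockExtension_wrap_three (t : BinaryTree Unit) :
    IsBlockExtension (2 * t.numNodes) t.mate (node () t (node () nil nil)).mate (· + 1)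
      (2 * t.numNodes + 1) (2 * t.numNodes + 2) (2 * t.numNodes + 3) 0 := by
  refine ⟨mate_node_close _ _, ?_, mate_node_zero _ _, ?_, fun x hx => mate_node_left _ _ hx⟩
  · rw [show 2 * t.numNodes + 2 = 0 + (2 * t.numNodes + 2) by omega, mate_node_right,
      mate_node_zero]
    simp only [numNodes]; omega
  · rw [show 2 * t.numNodes + 3 = 2 * (nil : BinaryTree Unit).numNodes + 1 +
      (2 * t.numNodes + 2) by simp only [numNodes]; omega, mate_node_right, mate_node_close]
    omega

end BinaryTree

/-! ### Matchings and block insertions in terms of trees -/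

namespace NCMatching

/-- The matching `M` is the one encoded by the binary tree `t`. -/
structure Encodes {k : ℕ} (t : BinaryTree Unit) (M : NCMatching k) : Prop where
  numNodes : t.numNodes = k
  partner : ∀ x, (M.partner x : ℕ) = t.mate x

lemma Encodes.eq_tree {k : ℕ} {s t : BinaryTree Unit} {M : NCMatching k} (hs : Encodes s M)
    (ht : Encodes t M) : s = t := by
  refine BinaryTree.eq_of_mate_eq (hs.numNodes.trans ht.numNodes.symm) fun x hx => ?_
  rw [hs.numNodes] at hx
  rw [← hs.partner ⟨x, hx⟩, ← ht.partner ⟨x, hx⟩]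

lemma Encodes.eq_matching {k : ℕ} {t : BinaryTree Unit} {M N : NCMatching k} (hM : Encodes t M)
    (hN : Encodes t N) : M = N := by
  ext x
  rw [hM.partner, hN.partner]

lemma exists_matching {k : ℕ} (t : BinaryTree Unit) (h : t.numNodes = k) :
    ∃ M : NCMatching k, Encodes t M := by
  subst h
  exact ⟨{  partner := fun x => ⟨t.mate x, t.mate_lt x x.2⟩
            partner_partner := fun x => Fin.ext (t.mate_mate x x.2)
            partner_ne := fun x h => t.mate_ne x x.2 (congrArg Fin.val h)
            noncrossing := fun x y h => t.mate_noncrossing x x.2 y y.2 h }, rfl, fun _ => rfl⟩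

lemma exists_tree {k : ℕ} (M : NCMatching k) : ∃ t, Encodes t M := by
  -- The extension by the identity is harmless, since a fixed point takes part in no crossing.
  let g : ℕ → ℕ := fun x => if h : x < 2 * k then M.partner ⟨x, h⟩ else x
  have hg : ∀ (x) (h : x < 2 * k), g x = M.partner ⟨x, h⟩ := fun x h => by simp [g, h]
  have hg' : ∀ x, ¬ x < 2 * k → g x = x := fun x h => by simp [g, h]
  obtain ⟨t, ht, ht'⟩ := BinaryTree.exists_mate_eq g (by
      intro x
      by_cases h : x < 2 * k
      · rw [hg x h, hg _ (M.partner _).2]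
        simp [M.partner_partner]
      · rw [hg' x h, hg' x h]) (by
      rintro x y ⟨h1, h2, h3⟩
      by_cases hx : x < 2 * k
      · rw [hg x hx] at h2 h3
        have hy : y < 2 * k := h2.trans (M.partner _).2
        rw [hg y hy] at h3
        exact M.noncrossing ⟨x, hx⟩ ⟨y, hy⟩ ⟨h1, h2, h3⟩
      · rw [hg' x hx] at h2
        omega) (2 * k) 0 (2 * k) (by omega) (by
      intro x _ hx
      rw [hg x hx]
      exact ⟨Nat.zero_le _, (M.partner _).2, fun h => M.partner_ne ⟨x, hx⟩ (Fin.ext h)⟩)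
  refine ⟨t, by omega, fun x => ?_⟩
  have := ht' x x.2
  rw [zero_add, zero_add, hg x x.2] at this
  exact this

/-- The extension at the points `p, q, r, s`, transported to `Fin`. -/
lemma isBlockInsertion_of_isBlockExtension {k : ℕ} {t t' : BinaryTree Unit} {M : NCMatching k}
    {N : NCMatching (k + 2)} (hM : Encodes t M) (hN : Encodes t' N) {σ : ℕ → ℕ}
    {p q r s : Fin (2 * (k + 2))}
    (hpq : Next p q) (hqr : Next q r) (hrs : Next r s)
    (f : Fin (2 * k) ↪o Fin (2 * (k + 2))) (hf : ∀ x, (f x : ℕ) = σ x)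
    (hr : Set.range f = ({p, q, r, s} : Set (Fin (2 * (k + 2))))ᶜ)
    (h : IsBlockExtension (2 * t.numNodes) t.mate t'.mate σ p q r s) :
    IsBlockInsertion M N := by
  refine ⟨p, q, r, s, hpq, hqr, hrs, Fin.ext ?_, Fin.ext ?_, f, hr, fun a => Fin.ext ?_⟩
  · rw [hN.partner, h.outer]
  · rw [hN.partner, h.inner]
  · rw [hN.partner, hf, hf, hM.partner, h.rest a (by rw [hM.numNodes]; exact a.2)]

/-- An insertion at the points `p, q, r, s` has the tree that an extension at them has. -/
lemma eq_of_isBlockExtension {k : ℕ} {t t' t'' : BinaryTree Unit} {M : NCMatching k}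
    {N : NCMatching (k + 2)} (hM : Encodes t M) (hN : Encodes t' N) {σ : ℕ → ℕ}
    {p q r s : Fin (2 * (k + 2))} (f f' : Fin (2 * k) ↪o Fin (2 * (k + 2)))
    (hf' : ∀ x, (f' x : ℕ) = σ x)
    (hr' : Set.range f' = ({p, q, r, s} : Set (Fin (2 * (k + 2))))ᶜ)
    (hr : Set.range f = ({p, q, r, s} : Set (Fin (2 * (k + 2))))ᶜ)
    (hps : N.partner p = s) (hqr : N.partner q = r) (hrest : ∀ a, N.partner (f a) = f (M.partner a))
    (hn : t''.numNodes = t.numNodes + 2)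
    (h : IsBlockExtension (2 * t.numNodes) t.mate t''.mate σ p q r s) : t' = t'' := by
  -- An increasing enumeration is determined by its range, so `M` and the four points determine `N`.
  obtain rfl : f = f' := OrderEmbedding.range_inj.1 (hr.trans hr'.symm)
  refine hN.eq_tree ⟨by rw [hn, hM.numNodes], fun x => ?_⟩
  by_cases hx : x ∈ ({p, q, r, s} : Set (Fin (2 * (k + 2))))
  · simp only [Set.mem_insert_iff, Set.mem_singleton_iff] at hx
    rcases hx with rfl | rfl | rfl | rfl
    · rw [hps, h.outer]
    · rw [hqr, h.inner]
    · rw [← hqr, N.partner_partner, hqr, h.inner']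
    · rw [← hps, N.partner_partner, hps, h.outer']
  · rw [← Set.mem_compl_iff, ← hr] at hx
    obtain ⟨y, rfl⟩ := hx
    rw [hrest, hf', hf', hM.partner, h.rest y (by rw [hM.numNodes]; exact y.2)]

/-- A strictly monotone map of `ℕ`, as an order embedding of finite intervals. -/
def finEmbedding (σ : ℕ → ℕ) (hσ : StrictMono σ) {m n : ℕ} (h : ∀ x < m, σ x < n) :
    Fin m ↪o Fin n :=
  OrderEmbedding.ofStrictMono (fun x => ⟨σ x, h x x.2⟩) fun _ _ hxy => hσ hxy

lemma finEmbedding_apply (σ : ℕ → ℕ) (hσ : StrictMono σ) {m n : ℕ} (h : ∀ x < m, σ x < n)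
    (x : Fin m) : (finEmbedding σ hσ h x : ℕ) = σ x := rfl

lemma range_finEmbedding (σ : ℕ → ℕ) (hσ : StrictMono σ) {m n : ℕ} (h : ∀ x < m, σ x < n)
    (p q r s : Fin n) (h1 : ∀ x < m, σ x ≠ p ∧ σ x ≠ q ∧ σ x ≠ r ∧ σ x ≠ s)
    (h2 : ∀ y < n, y ≠ p → y ≠ q → y ≠ r → y ≠ s → ∃ x < m, σ x = y) :
    Set.range (finEmbedding σ hσ h) = ({p, q, r, s} : Set (Fin n))ᶜ := by
  ext y
  simp only [Set.mem_range, Set.mem_compl_iff, Set.mem_insert_iff, Set.mem_singleton_iff,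
    not_or, Fin.ext_iff, finEmbedding_apply]
  constructor
  · rintro ⟨x, hx⟩
    rw [← hx]
    exact h1 x x.2
  · rintro ⟨e1, e2, e3, e4⟩
    obtain ⟨x, hx, e⟩ := h2 y y.2 e1 e2 e3 e4
    exact ⟨⟨x, hx⟩, e⟩

lemma strictMono_skipFour (p : ℕ) : StrictMono (skipFour p) := by
  intro x y hxy
  simp only [skipFour]
  split_ifs <;> omega

/-- Four cyclically consecutive points, according to where the cyclic order wraps around. -/
lemma next_cases {k : ℕ} {p q r s : Fin (2 * (k + 2))} (hpq : Next p q) (hqr : Next q r)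
    (hrs : Next r s) :
    ((q : ℕ) = p + 1 ∧ (r : ℕ) = p + 2 ∧ (s : ℕ) = p + 3) ∨
    ((p : ℕ) = 2 * k + 3 ∧ (q : ℕ) = 0 ∧ (r : ℕ) = 1 ∧ (s : ℕ) = 2) ∨
    ((p : ℕ) = 2 * k + 2 ∧ (q : ℕ) = 2 * k + 3 ∧ (r : ℕ) = 0 ∧ (s : ℕ) = 1) ∨
    ((p : ℕ) = 2 * k + 1 ∧ (q : ℕ) = 2 * k + 2 ∧ (r : ℕ) = 2 * k + 3 ∧ (s : ℕ) = 0) := by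
  have key : ∀ {a b : Fin (2 * (k + 2))}, Next a b →
      ((b : ℕ) = a + 1 ∨ ((a : ℕ) = 2 * k + 3 ∧ (b : ℕ) = 0)) := by
    intro a b h
    rcases Nat.lt_or_ge (a + 1 : ℕ) (2 * (k + 2)) with h1 | h1
    · left; rw [h, Nat.mod_eq_of_lt h1]
    · right
      have h2 : (a : ℕ) = 2 * k + 3 := by omega
      refine ⟨h2, ?_⟩
      rw [h, h2, show 2 * k + 3 + 1 = 2 * (k + 2) by omega, Nat.mod_self]
  have := key hpq
  have := key hqr
  have := key hrs
  omega

/-- `t` is obtained from `s` by inserting a block anywhere in the cyclic order. -/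
inductive CyclicInsertion : BinaryTree Unit → BinaryTree Unit → Prop
  | linear {t t'} : Insertion t t' → CyclicInsertion t t'
  | wrap_one (t) : CyclicInsertion t (node () nil (node () t nil))
  | wrap_two (t) : CyclicInsertion t (node () (node () t nil) nil)
  | wrap_three (t) : CyclicInsertion t (node () t (node () nil nil))

lemma next_of_eq {n : ℕ} {a b : Fin n} (h : (b : ℕ) = a + 1) : Next a b := by
  rw [Next, Nat.mod_eq_of_lt (h ▸ b.2), h]

lemma next_last {n : ℕ} {a b : Fin n} (h : (a : ℕ) + 1 = n) (h' : (b : ℕ) = 0) : Next a b := by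
  rw [Next, h, Nat.mod_self, h']

/-- `next_cases` locates the cut relative to the block. In each case an explicit tree extends `t` at
these four points, and the extension there is unique. -/
lemma isBlockInsertion_iff {k : ℕ} {t t' : BinaryTree Unit} {M : NCMatching k}
    {N : NCMatching (k + 2)} (hM : Encodes t M) (hN : Encodes t' N) :
    IsBlockInsertion M N ↔ CyclicInsertion t t' := by
  have hk := hM.numNodes
  have hlin : ∀ p ≤ 2 * k, ∀ x < 2 * k, skipFour p x < 2 * (k + 2) := by
    intro p hp x hx; simp only [skipFour]; split_ifs <;> omega
  have hlin1 : ∀ p x, skipFour p x ≠ p ∧ skipFour p x ≠ p + 1 ∧ skipFour p x ≠ p + 2 ∧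
      skipFour p x ≠ p + 3 := by
    intro p x; simp only [skipFour]; split_ifs <;> omega
  have hlin2 : ∀ p ≤ 2 * k, ∀ y < 2 * (k + 2), y ≠ p → y ≠ p + 1 → y ≠ p + 2 → y ≠ p + 3 →
      ∃ x < 2 * k, skipFour p x = y := by
    intro p hp y hy h0 h1 h2 h3
    rcases Nat.lt_or_ge y p with h | h
    · exact ⟨y, by omega, by simp [skipFour, h]⟩
    · exact ⟨y - 4, by omega, by simp only [skipFour]; split_ifs <;> omega⟩
  have hadd : ∀ c : ℕ, StrictMono (· + c) := fun c => strictMono_id.add_const c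
  constructor
  · rintro ⟨p, q, r, s, hpq, hqr, hrs, hps, hqr', f, hf, hrest⟩
    rcases next_cases hpq hqr hrs with ⟨e1, e2, e3⟩ | ⟨e0, e1, e2, e3⟩ | ⟨e0, e1, e2, e3⟩ |
      ⟨e0, e1, e2, e3⟩
    · have hp : (p : ℕ) ≤ 2 * k := by omega
      obtain ⟨t'', h1, h2⟩ := exists_insertion t p (by omega)
      rw [← e1, ← e2, ← e3] at h2
      rw [eq_of_isBlockExtension hM hN f _
        (finEmbedding_apply _ (strictMono_skipFour p) (hlin p hp))
        (range_finEmbedding _ _ _ p q r s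
          (fun x _ => by rw [e1, e2, e3]; exact hlin1 p x)
          (by rw [e1, e2, e3]; exact hlin2 p hp)) hf hps hqr' hrest h1.numNodes h2]
      exact .linear h1
    · have h2 : IsBlockExtension (2 * t.numNodes) t.mate (BinaryTree.mate (node () nil (node () t nil)))
          (· + 3) p q r s := by
        rw [e0, e1, e2, e3, ← hk]
        exact isBlockExtension_wrap_one t
      rw [eq_of_isBlockExtension hM hN f _
        (finEmbedding_apply _ (hadd 3) (fun x hx => by omega))
        (range_finEmbedding _ _ _ p q r s
          (fun x _ => by omega)
          (fun y hy h0 h1 h2 h3 => ⟨y - 3, by omega, by omega⟩)) hf hps hqr' hrest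
        (by simp only [BinaryTree.numNodes] ; omega) h2]
      exact .wrap_one t
    · have h2 : IsBlockExtension (2 * t.numNodes) t.mate (BinaryTree.mate (node () (node () t nil) nil))
          (· + 2) p q r s := by
        rw [e0, e1, e2, e3, ← hk]
        exact isBlockExtension_wrap_two t
      rw [eq_of_isBlockExtension hM hN f _
        (finEmbedding_apply _ (hadd 2) (fun x hx => by omega))
        (range_finEmbedding _ _ _ p q r s
          (fun x _ => by omega)
          (fun y hy h0 h1 h2 h3 => ⟨y - 2, by omega, by omega⟩)) hf hps hqr' hrest
        (by simp only [BinaryTree.numNodes]) h2]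
      exact .wrap_two t
    · have h2 : IsBlockExtension (2 * t.numNodes) t.mate (BinaryTree.mate (node () t (node () nil nil)))
          (· + 1) p q r s := by
        rw [e0, e1, e2, e3, ← hk]
        exact isBlockExtension_wrap_three t
      rw [eq_of_isBlockExtension hM hN f _
        (finEmbedding_apply _ (hadd 1) (fun x hx => by omega))
        (range_finEmbedding _ _ _ p q r s
          (fun x _ => by omega)
          (fun y hy h0 h1 h2 h3 => ⟨y - 1, by omega, by omega⟩)) hf hps hqr' hrest
        (by simp only [BinaryTree.numNodes]) h2]
      exact .wrap_three t
  · rintro (h | _ | _ | _)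
    · obtain ⟨p, hp, h⟩ := h.exists_isBlockExtension
      rw [hk] at hp
      exact isBlockInsertion_of_isBlockExtension hM hN (p := ⟨p, by omega⟩)
        (q := ⟨p + 1, by omega⟩) (r := ⟨p + 2, by omega⟩) (s := ⟨p + 3, by omega⟩)
        (next_of_eq rfl) (next_of_eq rfl) (next_of_eq rfl) _
        (finEmbedding_apply _ (strictMono_skipFour p) (hlin p hp))
        (range_finEmbedding _ _ _ _ _ _ _ (fun x _ => hlin1 p x) (hlin2 p hp)) h
    · have h := isBlockExtension_wrap_one t
      refine isBlockInsertion_of_isBlockExtension hM hN (p := ⟨2 * t.numNodes + 3, by omega⟩)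
        (q := ⟨0, by omega⟩) (r := ⟨1, by omega⟩) (s := ⟨2, by omega⟩)
        (next_last (by first | omega | (simp only; omega)) rfl) (next_of_eq rfl) (next_of_eq rfl) _
        (finEmbedding_apply _ (hadd 3) (fun x hx => by omega))
        (range_finEmbedding _ _ _ _ _ _ _ (fun x _ => by first | omega | (simp only; omega))
          (fun y hy h0 h1 h2 h3 => ⟨y - 3, by first | omega | (simp only at *; omega), by first | omega | (simp only at *; omega)⟩)) h
    · have h := isBlockExtension_wrap_two t
      refine isBlockInsertion_of_isBlockExtension hM hN (p := ⟨2 * t.numNodes + 2, by omega⟩)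
        (q := ⟨2 * t.numNodes + 3, by omega⟩) (r := ⟨0, by omega⟩) (s := ⟨1, by omega⟩)
        (next_of_eq rfl) (next_last (by first | omega | (simp only; omega)) rfl) (next_of_eq rfl) _
        (finEmbedding_apply _ (hadd 2) (fun x hx => by omega))
        (range_finEmbedding _ _ _ _ _ _ _ (fun x _ => by first | omega | (simp only; omega))
          (fun y hy h0 h1 h2 h3 => ⟨y - 2, by first | omega | (simp only at *; omega), by first | omega | (simp only at *; omega)⟩)) h
    · have h := isBlockExtension_wrap_three t
      refine isBlockInsertion_of_isBlockExtension hM hN (p := ⟨2 * t.numNodes + 1, by omega⟩)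
        (q := ⟨2 * t.numNodes + 2, by omega⟩) (r := ⟨2 * t.numNodes + 3, by omega⟩)
        (s := ⟨0, by omega⟩)
        (next_of_eq rfl) (next_of_eq rfl) (next_last (by first | omega | (simp only; omega)) rfl) _
        (finEmbedding_apply _ (hadd 1) (fun x hx => by omega))
        (range_finEmbedding _ _ _ _ _ _ _ (fun x _ => by first | omega | (simp only; omega))
          (fun y hy h0 h1 h2 h3 => ⟨y - 1, by first | omega | (simp only at *; omega), by first | omega | (simp only at *; omega)⟩)) h

/-! ### Rings of size 2 and 3 -/

lemma isRing_iff {k : ℕ} {t : BinaryTree Unit} {M : NCMatching k} (hM : Encodes t M) :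
    M.IsRing ↔ ∀ x : Fin (2 * k),
      t.mate x = ((x : ℕ) + 1) % (2 * k) ∨ (x : ℕ) = (t.mate x + 1) % (2 * k) := by
  simp only [IsRing, Next, hM.partner]

lemma eq_of_numNodes_eq_one {t : BinaryTree Unit} (h : t.numNodes = 1) :
    t = node () nil nil := by
  rcases t with _ | ⟨_, _ | ⟨_, a, b⟩, _ | ⟨_, c, d⟩⟩ <;> simp at h ⊢

lemma eq_of_numNodes_eq_two {t : BinaryTree Unit} (h : t.numNodes = 2) :
    t = node () nil (node () nil nil) ∨ t = node () (node () nil nil) nil := by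
  rcases t with _ | ⟨_, a, b⟩
  · simp at h
  simp only [BinaryTree.numNodes] at h
  rcases Nat.eq_zero_or_pos a.numNodes with ha | ha
  · left
    rw [eq_of_numNodes_eq_one (t := b) (by omega)]
    cases a
    · rfl
    · simp at ha
  · right
    rw [eq_of_numNodes_eq_one (t := a) (by omega)]
    cases b
    · rfl
    · simp only [BinaryTree.numNodes] at h; omega

/-- All matchings of size `2` are rings. -/
lemma isRing_two_iff {t : BinaryTree Unit} {M : NCMatching 2} (hM : Encodes t M) :
    M.IsRing ↔ t = node () nil (node () nil nil) ∨ t = node () (node () nil nil) nil := by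
  refine ⟨fun _ => eq_of_numNodes_eq_two hM.numNodes, fun h => ?_⟩
  rw [isRing_iff hM]
  rcases h with rfl | rfl <;> decide

/-- The two rings of size `3`. -/
lemma isRing_three_iff {t : BinaryTree Unit} {M : NCMatching 3} (hM : Encodes t M) :
    M.IsRing ↔ t = node () nil (node () nil (node () nil nil)) ∨
      t = node () (node () nil (node () nil nil)) nil := by
  rw [isRing_iff hM]
  constructor
  · intro h
    have hn := hM.numNodes
    clear hM M
    rcases t with _ | ⟨⟨⟩, a, b⟩
    · simp at hn
    simp only [BinaryTree.numNodes] at hn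
    -- Of the five trees with three nodes, the three that are not rings are refuted by evaluation.
    obtain ha | ha | ha : a.numNodes = 0 ∨ a.numNodes = 1 ∨ a.numNodes = 2 := by omega
    · rcases eq_of_numNodes_eq_two (t := b) (by omega) with rfl | rfl
      · cases a
        · exact Or.inl rfl
        · simp at ha
      · cases a
        · revert h; decide
        · simp at ha
    · rw [eq_of_numNodes_eq_one ha, eq_of_numNodes_eq_one (t := b) (by omega)] at h ⊢
      revert h; decide
    · obtain rfl : b = nil := by
        cases b
        · rfl
        · simp only [BinaryTree.numNodes] at hn; omega
      rcases eq_of_numNodes_eq_two ha with rfl | rfl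
      · exact Or.inr rfl
      · revert h; decide
  · rintro (rfl | rfl) <;> decide

/-! ### The grammar of L-matchings -/

/-- The classes of binary trees that make up the trees of L-matchings: hung trees (`T`), the trees
under their outer edges (`O`), the trees rooted at the centre of a base of two edges (`E`), the
trees that contain such a base elsewhere or at the root (`F`) with those under the edges leading
to the base (`Q`), and the trees (`G`) with a base of three edges, with those under the edges
leading to the base (`H`). -/
inductive TreeClass
  | T | O | E | F | Q | G | H

open TreeClass

/-- Membership of binary trees in the classes. -/
inductive TreeClass.Mem : TreeClass → BinaryTree Unit → Prop
  | nil : Mem T nil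
  | cons {c a b} : Mem O a → Mem c b → Mem c (node () a b)
  | oTT {a b} : Mem T a → Mem T b → Mem O (node () a b)
  | eTO {a b} : Mem T a → Mem O b → Mem E (node () a b)
  | fTO {a b} : Mem T a → Mem O b → Mem F (node () a b)
  | fFO {a b} : Mem F a → Mem O b → Mem F (node () a b)
  | fTQ {a b} : Mem T a → Mem Q b → Mem F (node () a b)
  | fQT {a b} : Mem Q a → Mem T b → Mem F (node () a b)
  | qFT {a b} : Mem F a → Mem T b → Mem Q (node () a b)
  | gTE {a b} : Mem T a → Mem E b → Mem G (node () a b)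
  | gET {a b} : Mem E a → Mem T b → Mem G (node () a b)
  | gGO {a b} : Mem G a → Mem O b → Mem G (node () a b)
  | gTH {a b} : Mem T a → Mem H b → Mem G (node () a b)
  | gHT {a b} : Mem H a → Mem T b → Mem G (node () a b)
  | hGT {a b} : Mem G a → Mem T b → Mem H (node () a b)

/-- The parity of the number of edges of the trees of a class. -/
def TreeClass.parity : TreeClass → ℕ
  | T => 0 | O => 1 | E => 0 | F => 0 | Q => 1 | G => 1 | H => 0

lemma TreeClass.Mem.mod_two {c : TreeClass} {t : BinaryTree Unit} (h : c.Mem t) :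
    t.numNodes % 2 = c.parity := by
  induction h with
  | nil => rfl
  | @cons c a b _ _ iha ihb =>
    cases c <;> simp only [parity, BinaryTree.numNodes] at * <;> omega
  | _ => simp only [parity, BinaryTree.numNodes] at *; omega

/-- Every class is closed under insertions. -/
lemma TreeClass.Mem.insertion {c : TreeClass} {t t' : BinaryTree Unit} (h : c.Mem t)
    (hi : Insertion t t') : c.Mem t' := by
  induction hi generalizing c with
  | here t => exact .cons (.oTT .nil .nil) h
  | left b _ ih =>
    cases h with
    | cons ha hb => exact .cons (ih ha) hb
    | oTT ha hb => exact .oTT (ih ha) hb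
    | eTO ha hb => exact .eTO (ih ha) hb
    | fTO ha hb => exact .fTO (ih ha) hb
    | fFO ha hb => exact .fFO (ih ha) hb
    | fTQ ha hb => exact .fTQ (ih ha) hb
    | fQT ha hb => exact .fQT (ih ha) hb
    | qFT ha hb => exact .qFT (ih ha) hb
    | gTE ha hb => exact .gTE (ih ha) hb
    | gET ha hb => exact .gET (ih ha) hb
    | gGO ha hb => exact .gGO (ih ha) hb
    | gTH ha hb => exact .gTH (ih ha) hb
    | gHT ha hb => exact .gHT (ih ha) hb
    | hGT ha hb => exact .hGT (ih ha) hb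
  | right a _ ih =>
    cases h with
    | cons ha hb => exact .cons ha (ih hb)
    | oTT ha hb => exact .oTT ha (ih hb)
    | eTO ha hb => exact .eTO ha (ih hb)
    | fTO ha hb => exact .fTO ha (ih hb)
    | fFO ha hb => exact .fFO ha (ih hb)
    | fTQ ha hb => exact .fTQ ha (ih hb)
    | fQT ha hb => exact .fQT ha (ih hb)
    | qFT ha hb => exact .qFT ha (ih hb)
    | gTE ha hb => exact .gTE ha (ih hb)
    | gET ha hb => exact .gET ha (ih hb)
    | gGO ha hb => exact .gGO ha (ih hb)
    | gTH ha hb => exact .gTH ha (ih hb)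
    | gHT ha hb => exact .gHT ha (ih hb)
    | hGT ha hb => exact .hGT ha (ih hb)

/-- The trees of L-matchings. -/
def LTree (t : BinaryTree Unit) : Prop := (t ≠ nil ∧ T.Mem t) ∨ F.Mem t ∨ G.Mem t

lemma CyclicInsertion.ne_nil {t t' : BinaryTree Unit} (h : CyclicInsertion t t') : t' ≠ nil := by
  rcases h with h | _ | _ | _
  · cases h <;> simp
  all_goals simp

/-- Straddling blocks enclose the whole tree. Around a T-tree, two nested edges give a T-tree again,
while the other two shapes create a base of two edges and land in F. An F- or G-tree keeps its
class, passing through Q or H, or through `fFO` or `gGO`. -/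
lemma LTree.cyclicInsertion {t t' : BinaryTree Unit} (h : LTree t) (hi : CyclicInsertion t t') :
    LTree t' := by
  have hne := hi.ne_nil
  rcases hi with hi | _ | _ | _
  · rcases h with ⟨-, h⟩ | h | h
    · exact Or.inl ⟨hne, h.insertion hi⟩
    · exact Or.inr (Or.inl (h.insertion hi))
    · exact Or.inr (Or.inr (h.insertion hi))
  · rcases h with ⟨-, h⟩ | h | h
    · exact Or.inr (Or.inl (.fTO .nil (.oTT h .nil)))
    · exact Or.inr (Or.inl (.fTQ .nil (.qFT h .nil)))
    · exact Or.inr (Or.inr (.gTH .nil (.hGT h .nil)))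
  · rcases h with ⟨-, h⟩ | h | h
    · exact Or.inl ⟨hne, .cons (.oTT h .nil) .nil⟩
    · exact Or.inr (Or.inl (.fQT (.qFT h .nil) .nil))
    · exact Or.inr (Or.inr (.gHT (.hGT h .nil) .nil))
  · rcases h with ⟨-, h⟩ | h | h
    · exact Or.inr (Or.inl (.fTO h (.oTT .nil .nil)))
    · exact Or.inr (Or.inl (.fFO h (.oTT .nil .nil)))
    · exact Or.inr (Or.inr (.gGO h (.oTT .nil .nil)))

lemma lTree_of_isLMatching {k : ℕ} {M : NCMatching k} (h : M.IsLMatching) :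
    ∀ t, Encodes t M → LTree t := by
  induction h with
  | ring_two M hM =>
    intro t ht
    rcases (isRing_two_iff ht).1 hM with rfl | rfl
    · exact Or.inr (Or.inl (.fTO .nil (.oTT .nil .nil)))
    · exact Or.inl ⟨by simp, .cons (.oTT .nil .nil) .nil⟩
  | ring_three M hM =>
    intro t ht
    rcases (isRing_three_iff ht).1 hM with rfl | rfl
    · exact Or.inr (Or.inr (.gTE .nil (.eTO .nil (.oTT .nil .nil))))
    · exact Or.inr (Or.inr (.gET (.eTO .nil (.oTT .nil .nil)) .nil))
  | insert_block M N _ hi ih =>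
    intro t' ht'
    obtain ⟨t, ht⟩ := exists_tree M
    exact (ih t ht).cyclicInsertion ((isBlockInsertion_iff ht ht').1 hi)

/-- The matching encoded by `t` is an L-matching. -/
def EncodesLMatching (t : BinaryTree Unit) : Prop :=
  ∀ (k : ℕ) (M : NCMatching k), Encodes t M → M.IsLMatching

lemma EncodesLMatching.cyclicInsertion {t t' : BinaryTree Unit} (h : EncodesLMatching t)
    (hi : CyclicInsertion t t') : EncodesLMatching t' := by
  intro k N hN
  have hn : t'.numNodes = t.numNodes + 2 := by
    rcases hi with hi | _ | _ | _
    · exact hi.numNodes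
    all_goals simp only [BinaryTree.numNodes, zero_add, add_zero]
  obtain rfl : k = t.numNodes + 2 := hN.numNodes.symm.trans hn
  obtain ⟨M, hM⟩ := exists_matching t rfl
  exact .insert_block M N (h _ M hM) ((isBlockInsertion_iff hM hN).2 hi)

/-- Reachability by insertions. -/
abbrev Insertions : BinaryTree Unit → BinaryTree Unit → Prop := Relation.ReflTransGen Insertion

lemma Insertions.node {a a' b b' : BinaryTree Unit} (ha : Insertions a a')
    (hb : Insertions b b') : Insertions (node () a b) (node () a' b') :=
  (ha.lift (fun a => BinaryTree.node () a b) fun _ _ h => .left b h).trans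
    (hb.lift (fun b => BinaryTree.node () a' b) fun _ _ h => .right a' h)

lemma EncodesLMatching.insertions {t t' : BinaryTree Unit} (h : EncodesLMatching t)
    (hi : Insertions t t') : EncodesLMatching t' := by
  induction hi with
  | refl => exact h
  | tail _ hi ih => exact ih.cyclicInsertion (.linear hi)

/-- What the trees of a class are generated from. -/
def TreeClass.Generated : TreeClass → BinaryTree Unit → Prop
  | T, t => Insertions BinaryTree.nil t
  | O, t => Insertions (node () BinaryTree.nil BinaryTree.nil) t
  | E, t => Insertions
      (node () BinaryTree.nil (node () BinaryTree.nil BinaryTree.nil)) t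
  | F, t => EncodesLMatching t
  | Q, t => ∃ s, EncodesLMatching s ∧ Insertions (node () s BinaryTree.nil) t
  | G, t => EncodesLMatching t
  | H, t => ∃ s, EncodesLMatching s ∧ Insertions (node () s BinaryTree.nil) t

lemma encodesLMatching_two {t : BinaryTree Unit} (h : t = node () nil (node () nil nil) ∨
    t = node () (node () nil nil) nil) : EncodesLMatching t := by
  intro k M hM
  have hn := hM.numNodes
  obtain rfl : k = 2 := by rcases h with rfl | rfl <;> simpa using hn.symm
  exact .ring_two M ((isRing_two_iff hM).2 h)

lemma encodesLMatching_three {t : BinaryTree Unit}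
    (h : t = node () nil (node () nil (node () nil nil)) ∨
      t = node () (node () nil (node () nil nil)) nil) : EncodesLMatching t := by
  intro k M hM
  have hn := hM.numNodes
  obtain rfl : k = 3 := by rcases h with rfl | rfl <;> simpa using hn.symm
  exact .ring_three M ((isRing_three_iff hM).2 h)

/-- A derivation is replayed production by production: set up the ring or straddling block at the
base, then grow the subtrees by linear insertions. -/
lemma TreeClass.Mem.generated {c : TreeClass} {t : BinaryTree Unit} (h : c.Mem t) :
    c.Generated t := by
  induction h with
  | nil => exact .refl
  | @cons c a b _ _ iha ihb =>
    -- The peeled edge is the outer edge of a block placed in front of `b`; the O-tree under it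
    -- grows from the inner edge.
    have key : ∀ s, Insertions s b → Insertions s (node () a b) := fun s h =>
      (Relation.ReflTransGen.tail h (.here b)).trans (Insertions.node iha .refl)
    cases c with
    | T => exact key _ ihb
    | O => exact key _ ihb
    | E => exact key _ ihb
    | F => exact EncodesLMatching.insertions ihb (key b .refl)
    | G => exact EncodesLMatching.insertions ihb (key b .refl)
    | Q => obtain ⟨s, hs, h⟩ := ihb; exact ⟨s, hs, key _ h⟩
    | H => obtain ⟨s, hs, h⟩ := ihb; exact ⟨s, hs, key _ h⟩
  | oTT _ _ iha ihb => exact Insertions.node iha ihb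
  | eTO _ _ iha ihb => exact Insertions.node iha ihb
  | fTO _ _ iha ihb =>
    exact (encodesLMatching_two (Or.inl rfl)).insertions (Insertions.node iha ihb)
  | fFO _ _ iha ihb | gGO _ _ iha ihb =>
    exact (EncodesLMatching.cyclicInsertion iha (.wrap_three _)).insertions
      (Insertions.node .refl ihb)
  | fTQ _ _ iha ihb | gTH _ _ iha ihb =>
    obtain ⟨s, hs, h⟩ := ihb
    exact (hs.cyclicInsertion (.wrap_one s)).insertions (Insertions.node iha h)
  | fQT _ _ iha ihb | gHT _ _ iha ihb =>
    obtain ⟨s, hs, h⟩ := iha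
    exact (hs.cyclicInsertion (.wrap_two s)).insertions (Insertions.node h ihb)
  | qFT _ _ iha ihb | hGT _ _ iha ihb => exact ⟨_, iha, Insertions.node .refl ihb⟩
  | gTE _ _ iha ihb =>
    exact (encodesLMatching_three (Or.inl rfl)).insertions (Insertions.node iha ihb)
  | gET _ _ iha ihb =>
    exact (encodesLMatching_three (Or.inr rfl)).insertions (Insertions.node iha ihb)

lemma LTree.encodesLMatching {t : BinaryTree Unit} (h : LTree t) : EncodesLMatching t := by
  rcases h with ⟨hne, h⟩ | h | h
  · cases h with
    | nil => exact absurd rfl hne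
    | cons ha hb =>
      exact (encodesLMatching_two (Or.inr rfl)).insertions
        (Insertions.node ha.generated hb.generated)
  · exact h.generated
  · exact h.generated

lemma isLMatching_iff {k : ℕ} {t : BinaryTree Unit} {M : NCMatching k} (hM : Encodes t M) :
    M.IsLMatching ↔ LTree t :=
  ⟨fun h => lTree_of_isLMatching h t hM, fun h => h.encodesLMatching k M hM⟩

lemma natCard_isLMatching (k : ℕ) :
    Nat.card {M : NCMatching k // M.IsLMatching} =
      Nat.card {t : BinaryTree Unit // t.numNodes = k ∧ LTree t} := by
  choose tree htree using fun M : NCMatching k => exists_tree M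
  refine Nat.card_congr (Equiv.ofBijective
    (fun M => ⟨tree M.1, (htree M.1).numNodes, (isLMatching_iff (htree M.1)).1 M.2⟩) ⟨?_, ?_⟩)
  · intro M N h
    have h' : tree M.1 = tree N.1 := congrArg Subtype.val h
    exact Subtype.ext ((htree M.1).eq_matching (h' ▸ htree N.1))
  · rintro ⟨t, ht, hL⟩
    obtain ⟨M, hM⟩ := exists_matching t ht
    exact ⟨⟨M, (isLMatching_iff hM).2 hL⟩, Subtype.ext ((htree M).eq_tree hM)⟩

/-! ### Generating functions of the classes -/

open TreeClass PowerSeries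

open Classical in
/-- The generating function of the trees with a given property, by number of edges. -/
noncomputable def treeSeries (P : BinaryTree Unit → Prop) : ℚ⟦X⟧ :=
  .mk fun n => ((treesOfNumNodesEq n).filter P).card

lemma coeff_treeSeries (P : BinaryTree Unit → Prop) (n : ℕ) :
    coeff n (treeSeries P) = Nat.card {t : BinaryTree Unit // t.numNodes = n ∧ P t} := by
  classical
  rw [treeSeries, coeff_mk, Nat.subtype_card]
  intro t
  rw [Finset.mem_filter, mem_treesOfNumNodesEq]

lemma treeSeries_congr {P Q : BinaryTree Unit → Prop} (h : ∀ t, P t ↔ Q t) :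
    treeSeries P = treeSeries Q := by
  rw [show P = Q from funext fun t => propext (h t)]

lemma treeSeries_or {P Q : BinaryTree Unit → Prop} (h : ∀ t, P t → ¬ Q t) :
    treeSeries (fun t => P t ∨ Q t) = treeSeries P + treeSeries Q := by
  classical
  ext n
  simp only [treeSeries, coeff_mk, map_add]
  rw [← Nat.cast_add, ← Finset.card_union_of_disjoint (Finset.disjoint_filter.2 fun t _ => h t),
    ← Finset.filter_or]
  congr

/-- The trees whose left and right subtrees have given properties. -/
def NodeOf (P Q : BinaryTree Unit → Prop) (t : BinaryTree Unit) : Prop :=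
  ∃ a b, P a ∧ Q b ∧ t = node () a b

lemma nodeOf_node {P Q : BinaryTree Unit → Prop} {a b : BinaryTree Unit} :
    NodeOf P Q (node () a b) ↔ P a ∧ Q b := by
  simp [NodeOf]

lemma not_nodeOf_nil {P Q : BinaryTree Unit → Prop} : ¬ NodeOf P Q nil := by
  simp [NodeOf]

/-- The root contributes the factor X, and the sizes of the subtrees add up, which is the Cauchy
product. -/
lemma treeSeries_nodeOf (P Q : BinaryTree Unit → Prop) :
    treeSeries (NodeOf P Q) = X * (treeSeries P * treeSeries Q) := by
  classical
  ext n
  cases n with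
  | zero =>
    simp [treeSeries, not_nodeOf_nil, Finset.filter_singleton]
  | succ n =>
    rw [coeff_succ_X_mul, coeff_mul]
    simp only [treeSeries, coeff_mk]
    rw [treesOfNumNodesEq_succ, Finset.filter_biUnion, Finset.card_biUnion]
    · push_cast
      refine Finset.sum_congr rfl fun ij _ => ?_
      rw [← Nat.cast_mul, ← Finset.card_product, Finset.filter_map, Finset.card_map,
        ← Finset.filter_product]
      congr 2
      ext x
      simp only [Finset.mem_filter, Function.comp_apply]
      exact and_congr_right fun _ => nodeOf_node
    · intro x _ y _ hxy
      refine Finset.disjoint_left.2 fun t ht ht' => hxy ?_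
      simp only [Finset.mem_filter, Finset.mem_map, Finset.mem_product,
        mem_treesOfNumNodesEq] at ht ht'
      obtain ⟨⟨u, ⟨h1, h2⟩, rfl⟩, -⟩ := ht
      obtain ⟨⟨v, ⟨h3, h4⟩, h⟩, -⟩ := ht'
      replace h : node () v.1 v.2 = node () u.1 u.2 := h
      simp only [node.injEq, true_and] at h
      ext
      · rw [← h1, ← h3, h.1]
      · rw [← h2, ← h4, h.2]

lemma treeSeries_nil : treeSeries (fun t => t = nil) = 1 := by
  ext n
  rw [coeff_treeSeries, coeff_one]
  split_ifs with h
  · subst h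
    rw [Nat.cast_eq_one, Nat.card_eq_one_iff_exists]
    exact ⟨⟨nil, rfl, rfl⟩, fun t => Subtype.ext t.2.2⟩
  · rw [Nat.cast_eq_zero, Nat.card_eq_zero]
    refine Or.inl ⟨?_⟩
    rintro ⟨t, ht, rfl⟩
    exact h ht.symm

lemma mem_t_iff {t} : T.Mem t ↔ t = nil ∨ NodeOf O.Mem T.Mem t := by
  constructor
  · rintro (_ | _) <;> simp_all [nodeOf_node]
  · rintro (rfl | ⟨a, b, ha, hb, rfl⟩)
    exacts [.nil, .cons ha hb]

lemma mem_o_iff {t} : O.Mem t ↔ NodeOf O.Mem O.Mem t ∨ NodeOf T.Mem T.Mem t := by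
  constructor
  · rintro (_ | _) <;> simp_all [nodeOf_node]
  · rintro (⟨a, b, ha, hb, rfl⟩ | ⟨a, b, ha, hb, rfl⟩)
    exacts [.cons ha hb, .oTT ha hb]

lemma mem_e_iff {t} : E.Mem t ↔ NodeOf O.Mem E.Mem t ∨ NodeOf T.Mem O.Mem t := by
  constructor
  · rintro (_ | _) <;> simp_all [nodeOf_node]
  · rintro (⟨a, b, ha, hb, rfl⟩ | ⟨a, b, ha, hb, rfl⟩)
    exacts [.cons ha hb, .eTO ha hb]

lemma mem_f_iff {t} : F.Mem t ↔ NodeOf O.Mem F.Mem t ∨ NodeOf T.Mem O.Mem t ∨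
    NodeOf F.Mem O.Mem t ∨ NodeOf T.Mem Q.Mem t ∨ NodeOf Q.Mem T.Mem t := by
  constructor
  · rintro (_ | _) <;> simp_all [nodeOf_node]
  · rintro (⟨a, b, ha, hb, rfl⟩ | ⟨a, b, ha, hb, rfl⟩ | ⟨a, b, ha, hb, rfl⟩ |
      ⟨a, b, ha, hb, rfl⟩ | ⟨a, b, ha, hb, rfl⟩)
    exacts [.cons ha hb, .fTO ha hb, .fFO ha hb, .fTQ ha hb, .fQT ha hb]

lemma mem_q_iff {t} : Q.Mem t ↔ NodeOf O.Mem Q.Mem t ∨ NodeOf F.Mem T.Mem t := by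
  constructor
  · rintro (_ | _) <;> simp_all [nodeOf_node]
  · rintro (⟨a, b, ha, hb, rfl⟩ | ⟨a, b, ha, hb, rfl⟩)
    exacts [.cons ha hb, .qFT ha hb]

lemma mem_g_iff {t} : G.Mem t ↔ NodeOf O.Mem G.Mem t ∨ NodeOf T.Mem E.Mem t ∨
    NodeOf E.Mem T.Mem t ∨ NodeOf G.Mem O.Mem t ∨ NodeOf T.Mem H.Mem t ∨
    NodeOf H.Mem T.Mem t := by
  constructor
  · rintro (_ | _) <;> simp_all [nodeOf_node]
  · rintro (⟨a, b, ha, hb, rfl⟩ | ⟨a, b, ha, hb, rfl⟩ | ⟨a, b, ha, hb, rfl⟩ |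
      ⟨a, b, ha, hb, rfl⟩ | ⟨a, b, ha, hb, rfl⟩ | ⟨a, b, ha, hb, rfl⟩)
    exacts [.cons ha hb, .gTE ha hb, .gET ha hb, .gGO ha hb, .gTH ha hb, .gHT ha hb]

lemma mem_h_iff {t} : H.Mem t ↔ NodeOf O.Mem H.Mem t ∨ NodeOf G.Mem T.Mem t := by
  constructor
  · rintro (_ | _) <;> simp_all [nodeOf_node]
  · rintro (⟨a, b, ha, hb, rfl⟩ | ⟨a, b, ha, hb, rfl⟩)
    exacts [.cons ha hb, .hGT ha hb]

lemma TreeClass.Mem.false_of_parity {c d : TreeClass} {t : BinaryTree Unit} (h : c.Mem t)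
    (h' : d.Mem t) (hne : c.parity ≠ d.parity) : False :=
  hne (h.mod_two.symm.trans h'.mod_two)

/-- The classes of equal parity are disjoint, except that `F` contains `E`. -/
lemma disjoint_classes (t : BinaryTree Unit) : (T.Mem t → ¬ F.Mem t) ∧ (O.Mem t → ¬ Q.Mem t) ∧
    (G.Mem t → ¬ O.Mem t) ∧ (T.Mem t → ¬ E.Mem t) ∧ (T.Mem t → ¬ H.Mem t) ∧
    (E.Mem t → ¬ H.Mem t) := by
  induction t using unitRecOn with
  | base =>
    simp [mem_f_iff, mem_q_iff, mem_g_iff, mem_e_iff, mem_h_iff, not_nodeOf_nil]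
  | ind a b iha ihb =>
    -- Parities of the subtrees exclude most pairs of productions. The rest need the other
    -- disjointness claims for a subtree, hence the joint induction.
    have pa : ∀ c : TreeClass, c.Mem a → a.numNodes % 2 = c.parity := fun c h => h.mod_two
    have pb : ∀ c : TreeClass, c.Mem b → b.numNodes % 2 = c.parity := fun c h => h.mod_two
    have aT := pa T; have aO := pa O; have aE := pa E; have aF := pa F; have aQ := pa Q
    have aG := pa G; have aH := pa H
    have bT := pb T; have bO := pb O; have bE := pb E; have bF := pb F; have bQ := pb Q
    have bG := pb G; have bH := pb H
    clear pa pb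
    simp only [parity] at *
    rw [mem_t_iff, mem_o_iff, mem_e_iff, mem_f_iff, mem_q_iff, mem_g_iff, mem_h_iff]
    simp only [nodeOf_node, reduceCtorEq, false_or]
    refine ⟨?_, ?_, ?_, ?_, ?_, ?_⟩ <;> intro h h' <;> grind

lemma not_nodeOf_of_left {P Q P' Q' : BinaryTree Unit → Prop} (h : ∀ t, P t → ¬ P' t)
    (t : BinaryTree Unit) : NodeOf P Q t → ¬ NodeOf P' Q' t := by
  rintro ⟨a, b, ha, -, rfl⟩ h'
  exact h a ha (nodeOf_node.1 h').1

lemma not_nodeOf_of_right {P Q P' Q' : BinaryTree Unit → Prop} (h : ∀ t, Q t → ¬ Q' t)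
    (t : BinaryTree Unit) : NodeOf P Q t → ¬ NodeOf P' Q' t := by
  rintro ⟨a, b, -, hb, rfl⟩ h'
  exact h b hb (nodeOf_node.1 h').2

lemma TreeClass.not_mem_of_parity {c d : TreeClass} (hne : c.parity ≠ d.parity)
    (t : BinaryTree Unit) (h : c.Mem t) : ¬ d.Mem t :=
  fun h' => h.false_of_parity h' hne

/-- The generating function of a class. -/
noncomputable abbrev TreeClass.series (c : TreeClass) : ℚ⟦X⟧ := treeSeries c.Mem

lemma series_t : T.series = 1 + X * (O.series * T.series) := by
  refine (treeSeries_congr fun t => mem_t_iff).trans ?_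
  rw [treeSeries_or, treeSeries_nil,
    treeSeries_nodeOf]
  rintro t rfl
  exact not_nodeOf_nil

lemma series_o :
    O.series = X * (O.series * O.series) + X * (T.series * T.series) := by
  refine (treeSeries_congr fun t => mem_o_iff).trans ?_
  rw [treeSeries_or, treeSeries_nodeOf,
    treeSeries_nodeOf]
  exact not_nodeOf_of_left (not_mem_of_parity (c := O) (d := T) (by decide))

lemma series_e :
    E.series = X * (O.series * E.series) + X * (T.series * O.series) := by
  refine (treeSeries_congr fun t => mem_e_iff).trans ?_
  rw [treeSeries_or, treeSeries_nodeOf,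
    treeSeries_nodeOf]
  exact not_nodeOf_of_left (not_mem_of_parity (c := O) (d := T) (by decide))

lemma series_q :
    Q.series = X * (O.series * Q.series) + X * (F.series * T.series) := by
  refine (treeSeries_congr fun t => mem_q_iff).trans ?_
  rw [treeSeries_or, treeSeries_nodeOf,
    treeSeries_nodeOf]
  exact not_nodeOf_of_left (not_mem_of_parity (c := O) (d := F) (by decide))

lemma series_h :
    H.series = X * (O.series * H.series) + X * (G.series * T.series) := by
  refine (treeSeries_congr fun t => mem_h_iff).trans ?_
  rw [treeSeries_or, treeSeries_nodeOf,
    treeSeries_nodeOf]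
  exact not_nodeOf_of_left fun t h h' => (disjoint_classes t).2.2.1 h' h

lemma not_or {P Q R : BinaryTree Unit → Prop} (h : ∀ t, P t → ¬ Q t) (h' : ∀ t, P t → ¬ R t)
    (t : BinaryTree Unit) (ht : P t) : ¬ (Q t ∨ R t) :=
  not_or_intro (h t ht) (h' t ht)

lemma series_f :
    F.series = X * (O.series * F.series) + (X * (T.series * O.series) +
      (X * (F.series * O.series) + (X * (T.series * Q.series) + X * (Q.series * T.series)))) := by
  have tf := fun t => (disjoint_classes t).1
  have oq := fun t => (disjoint_classes t).2.1
  refine (treeSeries_congr fun t => mem_f_iff).trans ?_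
  rw [treeSeries_or, treeSeries_or, treeSeries_or, treeSeries_or]
  · simp only [treeSeries_nodeOf]
  · exact not_nodeOf_of_left (not_mem_of_parity (c := T) (d := Q) (by decide))
  · refine not_or (not_nodeOf_of_left fun t h h' => tf t h' h) ?_
    exact not_nodeOf_of_left (not_mem_of_parity (c := F) (d := Q) (by decide))
  · refine not_or (not_nodeOf_of_left tf) ?_
    refine not_or (not_nodeOf_of_right oq) ?_
    exact not_nodeOf_of_left (not_mem_of_parity (c := T) (d := Q) (by decide))
  · refine not_or (not_nodeOf_of_left (not_mem_of_parity (c := O) (d := T) (by decide))) ?_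
    refine not_or (not_nodeOf_of_left (not_mem_of_parity (c := O) (d := F) (by decide))) ?_
    refine not_or (not_nodeOf_of_left (not_mem_of_parity (c := O) (d := T) (by decide))) ?_
    exact not_nodeOf_of_left oq

lemma series_g :
    G.series = X * (O.series * G.series) + (X * (T.series * E.series) +
      (X * (E.series * T.series) + (X * (G.series * O.series) + (X * (T.series * H.series) +
        X * (H.series * T.series))))) := by
  have go := fun t => (disjoint_classes t).2.2.1
  have te := fun t => (disjoint_classes t).2.2.2.1
  have th := fun t => (disjoint_classes t).2.2.2.2.1
  have eh := fun t => (disjoint_classes t).2.2.2.2.2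
  refine (treeSeries_congr fun t => mem_g_iff).trans ?_
  rw [treeSeries_or, treeSeries_or, treeSeries_or, treeSeries_or, treeSeries_or]
  · simp only [treeSeries_nodeOf]
  · exact not_nodeOf_of_left th
  · refine not_or (not_nodeOf_of_left (not_mem_of_parity (c := G) (d := T) (by decide))) ?_
    exact not_nodeOf_of_left (not_mem_of_parity (c := G) (d := H) (by decide))
  · refine not_or (not_nodeOf_of_left (not_mem_of_parity (c := E) (d := G) (by decide))) ?_
    refine not_or (not_nodeOf_of_left fun t h h' => te t h' h) ?_
    exact not_nodeOf_of_left eh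
  · refine not_or (not_nodeOf_of_left te) ?_
    refine not_or (not_nodeOf_of_left (not_mem_of_parity (c := T) (d := G) (by decide))) ?_
    refine not_or (not_nodeOf_of_right eh) ?_
    exact not_nodeOf_of_left th
  · refine not_or (not_nodeOf_of_left (not_mem_of_parity (c := O) (d := T) (by decide))) ?_
    refine not_or (not_nodeOf_of_left (not_mem_of_parity (c := O) (d := E) (by decide))) ?_
    refine not_or (not_nodeOf_of_left fun t h h' => go t h' h) ?_
    refine not_or (not_nodeOf_of_left (not_mem_of_parity (c := O) (d := T) (by decide))) ?_
    exact not_nodeOf_of_left (not_mem_of_parity (c := O) (d := H) (by decide))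

/-- By `series_t`, T is the inverse of 1 - X·O, so multiplying by T removes the `cons` production
shared by all classes. -/
lemma eq_series_t_mul {Y R : ℚ⟦X⟧} (h : Y = X * (O.series * Y) + R) : Y = T.series * R := by
  linear_combination T.series * h - Y * series_t

lemma series_o_eq : O.series = X * T.series ^ 3 := by
  linear_combination eq_series_t_mul series_o

lemma series_t_eq : T.series = 1 + X ^ 2 * T.series ^ 4 := by
  linear_combination series_t + X * T.series * series_o_eq

lemma series_e_eq : E.series = X ^ 2 * T.series ^ 5 := by
  linear_combination eq_series_t_mul series_e + X * T.series ^ 2 * series_o_eq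

/-- The 3 collects one X²T⁴F from `fFO` and two from Q = XT²F, which occurs on either side of the
root. The same count appears for G. -/
lemma series_f_eq : F.series = X ^ 2 * T.series ^ 5 + 3 * X ^ 2 * T.series ^ 4 * F.series := by
  linear_combination eq_series_t_mul series_f +
    (X * T.series ^ 2 + X * T.series * F.series) * series_o_eq +
    2 * X * T.series ^ 2 * eq_series_t_mul series_q

lemma series_g_eq :
    G.series = 2 * X ^ 3 * T.series ^ 7 + 3 * X ^ 2 * T.series ^ 4 * G.series := by
  linear_combination eq_series_t_mul series_g + 2 * X * T.series ^ 2 * series_e_eq +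
    X * T.series * G.series * series_o_eq + 2 * X * T.series ^ 2 * eq_series_t_mul series_h

/-! ### Binomial series as powers of T -/

/-- The series of the binomial coefficients `(4 * n + r).choose n`, in the square of the
variable. -/
noncomputable def chooseSeries (r : ℕ) : ℚ⟦X⟧ :=
  .mk fun n => if Even n then ((2 * n + r).choose (n / 2) : ℚ) else 0

lemma coeff_chooseSeries (r n : ℕ) :
    coeff (2 * n) (chooseSeries r) = ((4 * n + r).choose n : ℚ) := by
  rw [chooseSeries, coeff_mk, if_pos (even_two_mul n), ← mul_assoc]
  simp

lemma coeff_zero_X_sq_mul (f : ℚ⟦X⟧) : coeff 0 (X ^ 2 * f) = 0 := by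
  rw [coeff_X_pow_mul']; simp

lemma coeff_one_X_sq_mul (f : ℚ⟦X⟧) : coeff 1 (X ^ 2 * f) = 0 := by
  rw [coeff_X_pow_mul']; simp

/-- Pascal's rule: lowering n by one in C(4n + r, n - 1) raises r by 4. -/
lemma chooseSeries_succ (r : ℕ) :
    chooseSeries (r + 1) = chooseSeries r + X ^ 2 * chooseSeries (r + 4) := by
  ext n
  rw [map_add]
  obtain _ | _ | n := n
  · simp [coeff_zero_X_sq_mul, chooseSeries]
  · simp [coeff_one_X_sq_mul, chooseSeries]
  · rw [show n + 1 + 1 = n + 2 from rfl, coeff_X_pow_mul]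
    simp only [chooseSeries, coeff_mk]
    by_cases h : Even n
    · have h' : Even (n + 2) := h.add even_two
      rw [if_pos h, if_pos h', if_pos h', show (n + 2) / 2 = n / 2 + 1 by omega,
        show 2 * (n + 2) + (r + 1) = 2 * n + (r + 4) + 1 by ring, Nat.choose_succ_succ,
        show 2 * (n + 2) + r = 2 * n + (r + 4) by ring]
      push_cast
      ring
    · have h' : ¬ Even (n + 2) := by simpa [Nat.even_add] using h
      rw [if_neg h, if_neg h', if_neg h', add_zero]

/-- Absorption: C(4m + 4, m + 1) = 4 C(4m + 3, m); the 1 is the constant term. -/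
lemma chooseSeries_zero : chooseSeries 0 = 1 + X ^ 2 * (4 * chooseSeries 3) := by
  ext n
  rw [map_add, coeff_one]
  obtain _ | _ | n := n
  · simp [coeff_zero_X_sq_mul, chooseSeries]
  · simp [coeff_one_X_sq_mul, chooseSeries]
  · rw [show n + 1 + 1 = n + 2 from rfl, coeff_X_pow_mul, if_neg (by omega), zero_add,
      show (4 : ℚ⟦X⟧) = C (4 : ℚ) from (map_ofNat C 4).symm, coeff_C_mul]
    simp only [chooseSeries, coeff_mk]
    by_cases h : Even n
    · have h' : Even (n + 2) := h.add even_two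
      rw [if_pos h, if_pos h']
      obtain ⟨m, rfl⟩ := even_iff_two_dvd.1 h
      have := Nat.add_one_mul_choose_eq (4 * m + 3) m
      rw [show (2 * m + 2) / 2 = m + 1 by omega, show 2 * m / 2 = m by omega,
        show 2 * (2 * m + 2) + 0 = 4 * m + 3 + 1 by ring,
        show 2 * (2 * m) + 3 = 4 * m + 3 by ring]
      have h2 : ((4 * m + 3 + 1 : ℕ) : ℚ) * ((4 * m + 3).choose m : ℚ) =
        ((4 * m + 3 + 1).choose (m + 1) : ℚ) * ((m + 1 : ℕ) : ℚ) := by exact_mod_cast this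
      have h3 : ((m : ℚ) + 1) ≠ 0 := by positivity
      push_cast at h2
      apply mul_right_cancel₀ h3
      linear_combination -h2
    · have h' : ¬ Even (n + 2) := by simpa [Nat.even_add] using h
      rw [if_neg h, if_neg h', mul_zero]

/-- A family of power series satisfying the recursion of `chooseSeries` is determined by its
first member. -/
lemma eq_zero_of_recursion {D : ℕ → ℚ⟦X⟧} (h0 : D 0 = 0)
    (h : ∀ r, D (r + 1) = D r + X ^ 2 * D (r + 4)) (r : ℕ) : D r = 0 := by
  suffices ∀ n r, coeff n (D r) = 0 by ext n; simp [this]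
  intro n
  -- The factor X² lowers the coefficient index but raises `r`, so the outer induction is on the
  -- index, for all `r` at once.
  induction n using Nat.strong_induction_on with
  | _ n ih =>
  intro r
  induction r with
  | zero => simp [h0]
  | succ r ihr =>
    rw [h, map_add, ihr, zero_add, coeff_X_pow_mul']
    split_ifs with hn
    · exact ih _ (by omega) _
    · rfl

/-- Both sides agree at r = 0 and obey the same recursion, because T^(r+1) = T^r + X²T^(r+4). -/
lemma chooseSeries_eq (r : ℕ) : chooseSeries r = chooseSeries 0 * T.series ^ r := by
  have := eq_zero_of_recursion (D := fun r => chooseSeries r - chooseSeries 0 * T.series ^ r)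
    (by simp) (fun r => by
      rw [chooseSeries_succ]
      linear_combination -chooseSeries 0 * T.series ^ r * series_t_eq) r
  exact sub_eq_zero.1 this

/-- Multiply `chooseSeries_zero` by T and replace X²T⁴ by T - 1. -/
lemma chooseSeries_zero_mul : chooseSeries 0 * (4 - 3 * T.series) = T.series := by
  linear_combination T.series * chooseSeries_zero + 4 * X ^ 2 * T.series * chooseSeries_eq 3 -
    4 * chooseSeries 0 * series_t_eq

lemma four_sub_ne_zero : (4 - 3 * T.series : ℚ⟦X⟧) ≠ 0 := by
  intro h
  have h1 := chooseSeries_zero_mul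
  rw [h, mul_zero] at h1
  have h2 := series_t_eq
  rw [← h1] at h2
  simp at h2

/-- The factor 1 - 3X²T⁴ in the equation for F is 4 - 3T, which can be cancelled in the domain of
power series. -/
lemma series_t_add_series_f :
    T.series + F.series = 3 * chooseSeries 0 - 2 * chooseSeries 1 := by
  apply mul_right_cancel₀ four_sub_ne_zero
  rw [chooseSeries_eq 1]
  linear_combination series_f_eq - (T.series + 3 * F.series) * series_t_eq -
    (3 - 2 * T.series) * chooseSeries_zero_mul

lemma series_g_eq_chooseSeries : G.series = X ^ 3 * (2 * chooseSeries 6) := by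
  apply mul_right_cancel₀ four_sub_ne_zero
  rw [chooseSeries_eq 6]
  linear_combination series_g_eq - 3 * G.series * series_t_eq -
    2 * X ^ 3 * T.series ^ 6 * chooseSeries_zero_mul

/-! ### Extraction of the counts -/

lemma card_of_even {k : ℕ} (hk : 1 ≤ k) (he : Even k) :
    (Nat.card {M : NCMatching k // M.IsLMatching} : ℚ) = coeff k (T.series + F.series) := by
  rw [← treeSeries_or fun t => (disjoint_classes t).1, coeff_treeSeries, natCard_isLMatching]
  congr 3
  ext t
  refine and_congr_right fun ht => ⟨?_, ?_⟩
  · rintro (⟨-, h⟩ | h | h)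
    · exact Or.inl h
    · exact Or.inr h
    · have := h.mod_two
      rw [ht, Nat.even_iff.1 he] at this
      exact absurd this (by decide)
  · rintro (h | h)
    -- T contains the empty tree, which is no L-matching; `1 ≤ k` excludes it.
    · refine Or.inl ⟨?_, h⟩
      rintro rfl
      simp only [BinaryTree.numNodes] at ht
      omega
    · exact Or.inr (Or.inl h)

lemma card_of_odd {k : ℕ} (ho : Odd k) :
    (Nat.card {M : NCMatching k // M.IsLMatching} : ℚ) = coeff k G.series := by
  rw [coeff_treeSeries, natCard_isLMatching]
  congr 3
  ext t
  refine and_congr_right fun ht => ⟨?_, fun h => Or.inr (Or.inr h)⟩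
  rintro (⟨-, h⟩ | h | h)
  · have := h.mod_two
    rw [ht, Nat.odd_iff.1 ho] at this
    exact absurd this (by decide)
  · have := h.mod_two
    rw [ht, Nat.odd_iff.1 ho] at this
    exact absurd this (by decide)
  · exact h

lemma coeff_of_even (m : ℕ) : coeff (2 * m) (T.series + F.series) =
    ((m : ℚ) + 1) / (3 * (m : ℚ) + 1) * ((4 * m).choose m : ℚ) := by
  rw [series_t_add_series_f, map_sub, show (3 : ℚ⟦X⟧) = C (3 : ℚ) from (map_ofNat C 3).symm,
    show (2 : ℚ⟦X⟧) = C (2 : ℚ) from (map_ofNat C 2).symm, coeff_C_mul, coeff_C_mul,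
    coeff_chooseSeries, coeff_chooseSeries, add_zero]
  -- In terms of C(4m, m), the claim is 3 - 2(4m + 1)/(3m + 1) = (m + 1)/(3m + 1).
  have h := Nat.choose_mul_succ_eq (4 * m) m
  rw [show 4 * m + 1 - m = 3 * m + 1 by omega] at h
  have h' : ((4 * m).choose m : ℚ) * (4 * m + 1) = ((4 * m + 1).choose m : ℚ) * (3 * m + 1) := by
    exact_mod_cast h
  have h3 : (3 * (m : ℚ) + 1) ≠ 0 := by positivity
  field_simp
  linear_combination 2 * h'

lemma coeff_of_odd (m : ℕ) : coeff (2 * m + 3) G.series =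
    2 / 3 * (((m : ℚ) + 1) / ((m : ℚ) + 2)) * ((4 * m + 6).choose (m + 1) : ℚ) := by
  rw [series_g_eq_chooseSeries, coeff_X_pow_mul,
    show (2 : ℚ⟦X⟧) = C (2 : ℚ) from (map_ofNat C 2).symm, coeff_C_mul, coeff_chooseSeries]
  have h := Nat.choose_succ_right_eq (4 * m + 6) m
  rw [show 4 * m + 6 - m = 3 * m + 6 by omega] at h
  have h' : ((4 * m + 6).choose (m + 1) : ℚ) * (m + 1) =
      ((4 * m + 6).choose m : ℚ) * (3 * m + 6) := by exact_mod_cast h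
  have h3 : ((m : ℚ) + 2) ≠ 0 := by positivity
  field_simp
  linear_combination -h'

end NCMatching

theorem mainTheorem7 (k : ℕ) (hk : 1 ≤ k) (ℓ : ℕ) (hℓ : ℓ = ⌈(k : ℚ) / 2⌉₊) :
    (Odd k →
      (Nat.card {M : NCMatching k // M.IsLMatching} : ℚ) =
        2 / 3 * (((ℓ : ℚ) - 1) / (ℓ : ℚ)) * (Nat.choose (4 * ℓ - 2) (ℓ - 1) : ℚ)) ∧
    (Even k →
      (Nat.card {M : NCMatching k // M.IsLMatching} : ℚ) =
        ((ℓ : ℚ) + 1) / (3 * (ℓ : ℚ) + 1) * (Nat.choose (4 * ℓ) ℓ : ℚ)) := by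
  constructor
  · intro ho
    rw [NCMatching.card_of_odd ho]
    obtain ⟨m, rfl⟩ := ho
    have hm : ℓ = m + 1 := by
      rw [hℓ, Nat.ceil_eq_iff (by omega)]
      push_cast
      constructor <;> linarith
    rw [hm]
    -- For k = 1 both sides vanish: ℓ - 1 = 0, and G is divisible by X³. Otherwise ℓ - 2 is the
    -- index in `coeff_of_odd`.
    cases m with
    | zero =>
      rw [NCMatching.series_g_eq_chooseSeries, PowerSeries.coeff_X_pow_mul']
      simp
    | succ m =>
      rw [show 2 * (m + 1) + 1 = 2 * m + 3 by ring, NCMatching.coeff_of_odd,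
        show 4 * (m + 1 + 1) - 2 = 4 * m + 6 by omega, Nat.add_sub_cancel]
      push_cast
      ring
  · intro he
    rw [NCMatching.card_of_even hk he]
    obtain ⟨m, rfl⟩ := even_iff_two_dvd.1 he
    have hm : ℓ = m := by
      rw [hℓ]
      push_cast
      rw [mul_div_cancel_left₀ _ two_ne_zero, Nat.ceil_natCast]
    rw [hm, NCMatching.coeff_of_even]
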